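/- Let $E$ be a Euclidean space of finite dimension $n$, let $0\le d\le n$, and let $G_d(E)$ be the Grassmannian of $d$-dimensional linear subspaces of $E$, topologized by identifying a subspace $V$ with the orthogonal projection onto $V$. Let $k_e:E\times E\to\mathbb{R}$ and $k_t:G_d(E)\times G_d(E)\to\mathbb{R}$ be positive (i.e. symmetric positive semidefinite) real kernels such that 1. $k_e$ is radial: $k_e(x,y)=h_e(|x-y|)$, where $h_e:[0,\infty)\to\mathbb{R}$ is continuous and nonnegative and $h_e(0)>0$; 2. $k_t$ is continuous and nonnegative on $G_d(E)\times G_d(E)$, and $k_t(u,u)>0$ for every $u\in G_d(E)$. Let $W$ be the reproducing kernel Hilbert space of real functions on $E\times G_d(E)$ with kernel $k\big((x,u),(y,v)\big)=k_e(x,y)\,k_t(u,v)$, and let $W'$ be its dual with the dual norm. A set $X\subset E$ is called $d$-rectifiable if it is $\mathcal{H}^d$-measurable, $\mathcal{H}^d(X)<\infty$, and $\mathcal{H}^d$-almost all of $X$ is contained in a countable union of Lipschitz images of $\mathbb{R}^d$. For such $X$ let $T_xX\in G_d(E)$ denote the approximate tangent space, which exists at $\mathcal{H}^d$-almost every $x\in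 X$, and let $\mu_X$ be the varifold (finite Borel measure on $E\times G_d(E)$) given by $\mu_X(A)=\mathcal{H}^d(\{x\in X : (x,T_xX)\in A\})$. Then there is a constant $C>0$, independent of $X$, such that for every $d$-rectifiable set $X$ contained in the unit ball $\{x : |x|\le 1\}$ of $E$, the varifold $\mu_X$ defines a continuous linear form $\omega\mapsto\int\omega\,d\mu_X$ on $W$, and $$\|\mu_X\|_{W'}\ \ge\ C\,\mathcal{H}^d(X).$$ -/

import Mathlib

open MeasureTheory Filter Topology

noncomputable section

namespace Varifold

/-- The Grassmannian `G_d(E)`: the set of all `d`-dimensional linear subspaces of `E`. -/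
def Grassmannian (d : ℕ) (E : Type*) [NormedAddCommGroup E] [InnerProductSpace ℝ E] : Type _ :=
  {V : Submodule ℝ E // Module.finrank ℝ V = d}

section Grassmannian

variable {E : Type*} [NormedAddCommGroup E] [InnerProductSpace ℝ E] [FiniteDimensional ℝ E]
  {d : ℕ}

/-- The orthogonal projection `p_V : E → E` onto `V`. -/
def Grassmannian.proj (V : Grassmannian d E) : E →L[ℝ] E :=
  V.1.starProjection

/-- The usual topology of `G_d(E)`, induced by the embedding `V ↦ p_V` into the linear
endomorphisms of `E`. -/
instance : TopologicalSpace (Grassmannian d E) :=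
  TopologicalSpace.induced Grassmannian.proj inferInstance

/-- The Borel `σ`-algebra of `G_d(E)`. -/
instance : MeasurableSpace (Grassmannian d E) :=
  borel _

instance : BorelSpace (Grassmannian d E) :=
  ⟨rfl⟩

end Grassmannian

theorem Grassmannian.nonempty {E : Type*} [NormedAddCommGroup E] [InnerProductSpace ℝ E] {d : ℕ}
    (hd : d ≤ Module.finrank ℝ E) : Nonempty (Grassmannian d E) := by
  obtain ⟨f, hf⟩ := exists_linearIndependent_of_le_finrank hd
  exact ⟨⟨Submodule.span ℝ (Set.range f), by
    rw [finrank_span_eq_card hf, Fintype.card_fin]⟩⟩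

section Rectifiable

variable {E : Type*} [NormedAddCommGroup E] [InnerProductSpace ℝ E] [FiniteDimensional ℝ E]
  [MeasurableSpace E] [BorelSpace E] {d : ℕ}

/-- `X ⊆ E` is a `d`-dimensional rectifiable set: it is `ℋ^d`-measurable, `ℋ^d(X) < ∞`, and
`ℋ^d`-almost all of `X` is covered by countably many Lipschitz images of `ℝ^d`. -/
def IsRectifiable (d : ℕ) (X : Set E) : Prop :=
  NullMeasurableSet X μHE[d] ∧ μHE[d] X < ⊤ ∧
    ∃ f : ℕ → EuclideanSpace ℝ (Fin d) → E,
      (∀ i, ∃ K, LipschitzWith K (f i)) ∧ μHE[d] (X \ ⋃ i, Set.range (f i)) = 0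

/-- `V` is the (approximate) tangent space of `X` at `x`: the measures `ℋ^d ⌞ ((X - x) / r)`
converge to `ℋ^d ⌞ V` when `r ↓ 0`, tested against continuous functions of compact support. The
integral over `(X - x) / r` is written as an integral over `X`. Such a `V` is unique if it
exists. -/
def IsTangentSpace (X : Set E) (x : E) (V : Grassmannian d E) : Prop :=
  ∀ f : E → ℝ, Continuous f → HasCompactSupport f →
    Tendsto (fun r : ℝ => (r ^ d)⁻¹ * ∫ y in X, f (r⁻¹ • (y - x)) ∂μHE[d]) (𝓝[>] 0)
      (𝓝 (∫ y in (V.1 : Set E), f y ∂μHE[d]))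

open Classical in
/-- The tangent space `T_x X`. For a rectifiable set `X` it exists at `ℋ^d`-almost every `x ∈ X`;
at the other points the value is an arbitrary fixed `d`-dimensional subspace. -/
def tangentSpace (hd : d ≤ Module.finrank ℝ E) (X : Set E) (x : E) : Grassmannian d E :=
  if h : ∃ V : Grassmannian d E, IsTangentSpace X x V then h.choose
  else (Grassmannian.nonempty hd).some

/-- The varifold `μ_X` of a rectifiable set `X`, a measure on `E × G_d(E)`:
`μ_X(A) = ℋ^d {x ∈ X | (x, T_x X) ∈ A}`. -/
def rectifiableVarifold (hd : d ≤ Module.finrank ℝ E) (X : Set E) :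
    Measure (E × Grassmannian d E) :=
  Measure.map (fun x => (x, tangentSpace hd X x)) ((μHE[d] : Measure E).restrict X)

end Rectifiable

end Varifold

end

/-! The closed unit ball times the Grassmannian is compact. Since the kernel is nonnegative,
continuous and positive on the diagonal, a finite sum `ω` of its sections satisfies `ω ≥ c > 0`
there (`exists_forall_le_apply`). Testing `μ_X` on `ω` gives at least `c` times its total mass, and
`ω` does not depend on `X`. The linear form itself is the inner product with the Bochner integral of
the feature map (`exists_dual_eq_integral`).

The laborious point is that `μ_X` has total mass `ℋ^d(X)`. A pushforward along a map that is not
a.e. measurable is `0` by convention, so `x ↦ T_x X` must be shown measurable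
(`measurable_tangentSpace`). A subspace is encoded by its integrals against countably many test
functions, and the tangent space becomes a limit of measurable functions. -/

namespace Varifold

/-! ### The Grassmannian as a compact quotient of the Stiefel manifold. -/

section Topology

variable {E : Type*} [NormedAddCommGroup E] [InnerProductSpace ℝ E] {d : ℕ}

/-- The Stiefel manifold: linear isometries from `ℝ^d` to `E`, as a subtype of the continuous
linear maps. -/
abbrev Stiefel (d : ℕ) (E : Type*) [NormedAddCommGroup E] [InnerProductSpace ℝ E] : Type _ :=
  {φ : EuclideanSpace ℝ (Fin d) →L[ℝ] E // ∀ z, ‖φ z‖ = ‖z‖}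

/-- The linear isometry underlying a point of the Stiefel manifold. -/
def Stiefel.toLinearIsometry (φ : Stiefel d E) : EuclideanSpace ℝ (Fin d) →ₗᵢ[ℝ] E :=
  ⟨φ.1.toLinearMap, φ.2⟩

/-- The range of a linear isometry, as a point of the Grassmannian. -/
def Stiefel.range (φ : Stiefel d E) : Grassmannian d E :=
  ⟨φ.1.toLinearMap.range,
    (LinearMap.finrank_range_of_inj φ.toLinearIsometry.injective).trans finrank_euclideanSpace_fin⟩

theorem Stiefel.hasCompactSupport_comp (φ : Stiefel d E) {f : E → ℝ} (hs : HasCompactSupport f) :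
    HasCompactSupport fun z => f (φ.1 z) :=
  hs.comp_isClosedEmbedding φ.toLinearIsometry.isometry.isClosedEmbedding

theorem Stiefel.coe_range (φ : Stiefel d E) :
    (φ.range.1 : Set E) = Set.range φ.1 :=
  rfl

theorem Stiefel.setIntegral_range [MeasurableSpace E] [BorelSpace E] (φ : Stiefel d E)
    (f : E → ℝ) :
    ∫ y in (φ.range.1 : Set E), f y ∂μHE[d] = ∫ z, f (φ.1 z) := by
  have hφ : Isometry φ.1 := φ.toLinearIsometry.isometry
  rw [φ.coe_range, ← hφ.map_euclideanHausdorffMeasure,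
    hφ.isClosedEmbedding.measurableEmbedding.integral_map,
    EuclideanSpace.euclideanHausdorffMeasure_eq_volume]

variable [FiniteDimensional ℝ E]

theorem Grassmannian.proj_injective : Function.Injective (Grassmannian.proj : Grassmannian d E → _) :=
  fun _ _ h => Subtype.ext (Submodule.starProjection_inj.1 h)

theorem Grassmannian.isEmbedding_proj :
    IsEmbedding (Grassmannian.proj : Grassmannian d E → E →L[ℝ] E) :=
  ⟨⟨rfl⟩, proj_injective⟩

instance : T2Space (Grassmannian d E) :=
  Grassmannian.isEmbedding_proj.t2Space

instance : SecondCountableTopology (Grassmannian d E) :=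
  have : ProperSpace (E →L[ℝ] E) := FiniteDimensional.proper ℝ _
  Grassmannian.isEmbedding_proj.secondCountableTopology

instance : CompactSpace (Stiefel d E) := by
  have : ProperSpace (EuclideanSpace ℝ (Fin d) →L[ℝ] E) := FiniteDimensional.proper ℝ _
  refine isCompact_iff_compactSpace.1 (Metric.isCompact_of_isClosed_isBounded
    (s := {φ : EuclideanSpace ℝ (Fin d) →L[ℝ] E | ∀ z, ‖φ z‖ = ‖z‖}) ?_ ?_)
  · simp only [Set.ofPred_forall]
    exact isClosed_iInter fun z => isClosed_eq (by fun_prop) continuous_const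
  · refine (Metric.isBounded_closedBall (x := 0) (r := 1)).subset fun φ hφ => ?_
    rw [mem_closedBall_zero_iff]
    exact ContinuousLinearMap.opNorm_le_bound _ zero_le_one fun z => by rw [hφ z, one_mul]

theorem Stiefel.proj_range (φ : Stiefel d E) :
    φ.range.proj = φ.1 ∘L φ.1.adjoint := by
  ext u
  refine Submodule.eq_starProjection_of_mem_of_inner_eq_zero ⟨_, rfl⟩ ?_
  rintro _ ⟨z, rfl⟩
  have h : inner ℝ (φ.1 (φ.1.adjoint u)) (φ.1 z) = inner ℝ (φ.1.adjoint u) z :=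
    φ.toLinearIsometry.inner_map_map _ _
  rw [inner_sub_left]
  change inner ℝ u (φ.1 z) - inner ℝ (φ.1 (φ.1.adjoint u)) (φ.1 z) = 0
  rw [h, ContinuousLinearMap.adjoint_inner_left, sub_self]

theorem Stiefel.continuous_range : Continuous (Stiefel.range : Stiefel d E → _) := by
  refine Grassmannian.isEmbedding_proj.continuous_iff.2 ?_
  have : Grassmannian.proj ∘ (Stiefel.range : Stiefel d E → _) =
      fun φ => φ.1 ∘L φ.1.adjoint := funext Stiefel.proj_range
  rw [this]
  have h : Continuous fun φ : Stiefel d E => φ.1 := continuous_subtype_val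
  exact h.clm_comp (ContinuousLinearMap.adjoint.continuous.comp h)

theorem Stiefel.range_surjective : Function.Surjective (Stiefel.range : Stiefel d E → _) := by
  rintro ⟨V, rfl⟩
  let b := stdOrthonormalBasis ℝ V
  let φ := V.subtypeₗᵢ.comp b.repr.symm.toLinearIsometry
  refine ⟨⟨φ.toContinuousLinearMap, φ.norm_map⟩, Subtype.ext (SetLike.coe_injective ?_)⟩
  ext x
  constructor
  · rintro ⟨z, rfl⟩
    exact (b.repr.symm z).2
  · intro hx
    exact ⟨b.repr ⟨x, hx⟩, by simp [φ]⟩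

theorem Stiefel.isQuotientMap_range : IsQuotientMap (Stiefel.range : Stiefel d E → _) :=
  .of_surjective_continuous range_surjective continuous_range

instance : CompactSpace (Grassmannian d E) :=
  Stiefel.range_surjective.compactSpace Stiefel.continuous_range

variable [MeasurableSpace E] [BorelSpace E]

/-- On the Stiefel manifold the integral runs over the fixed space `ℝ^d`. Isometries preserve norms,
so all integrands vanish outside one ball, and dominated convergence applies. -/
theorem Grassmannian.continuous_setIntegral {f : E → ℝ} (hf : Continuous f)
    (hs : HasCompactSupport f) :
    Continuous fun V : Grassmannian d E => ∫ y in (V.1 : Set E), f y ∂μHE[d] := by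
  rw [Stiefel.isQuotientMap_range.continuous_iff]
  have : (fun V : Grassmannian d E => ∫ y in (V.1 : Set E), f y ∂μHE[d]) ∘ Stiefel.range =
      fun φ : Stiefel d E => ∫ z, f (φ.1 z) := funext fun φ => φ.setIntegral_range f
  rw [this]
  obtain ⟨M, hM⟩ := hs.exists_bound_of_continuous hf
  obtain ⟨R, hR⟩ := hs.isCompact.isBounded.exists_norm_le
  refine continuous_of_dominated
    (bound := (Metric.closedBall (0 : EuclideanSpace ℝ (Fin d)) R).indicator fun _ => M)
    (fun φ => ?_) (fun φ => ae_of_all _ fun z => ?_) ?_ (ae_of_all _ fun z => ?_)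
  · exact (hf.comp φ.1.continuous).aestronglyMeasurable
  · by_cases hz : z ∈ Metric.closedBall (0 : EuclideanSpace ℝ (Fin d)) R
    · rw [Set.indicator_of_mem hz]
      exact hM _
    · have : f (φ.1 z) = 0 := by
        by_contra h
        have := hR _ (subset_tsupport f h)
        rw [φ.2 z] at this
        exact hz (mem_closedBall_zero_iff.2 this)
      rw [Set.indicator_of_notMem hz, this, norm_zero]
  · exact (integrable_indicator_iff Metric.isClosed_closedBall.measurableSet).2
      (integrableOn_const (by exact (isCompact_closedBall _ _).measure_lt_top.ne))
  · have h : Continuous fun φ : Stiefel d E => φ.1 z :=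
      (ContinuousLinearMap.apply ℝ E z).continuous.comp continuous_subtype_val
    exact hf.comp h

theorem Grassmannian.integrableOn {f : E → ℝ} (hf : Continuous f) (hs : HasCompactSupport f)
    (V : Grassmannian d E) : IntegrableOn f (V.1 : Set E) μHE[d] := by
  obtain ⟨φ, rfl⟩ := Stiefel.range_surjective V
  have hφ : Isometry φ.1 := φ.toLinearIsometry.isometry
  rw [IntegrableOn, φ.coe_range, ← hφ.map_euclideanHausdorffMeasure,
    hφ.isClosedEmbedding.measurableEmbedding.integrable_map_iff,
    EuclideanSpace.euclideanHausdorffMeasure_eq_volume]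
  exact (hf.comp φ.1.continuous).integrable_of_hasCompactSupport (φ.hasCompactSupport_comp hs)

/-- A subspace is determined by the integrals of test functions over it. -/
theorem Grassmannian.ext_of_setIntegral_eq {V V' : Grassmannian d E}
    (h : ∀ f : E → ℝ, Continuous f → HasCompactSupport f →
      ∫ y in (V.1 : Set E), f y ∂μHE[d] = ∫ y in (V'.1 : Set E), f y ∂μHE[d]) : V = V' := by
  -- With equal dimensions, inclusion suffices. Otherwise a bump at some `v ∈ V \ V'`, zero on `V'`,
  -- has positive integral over `V` only.
  refine Subtype.ext (Submodule.eq_of_le_of_finrank_eq (fun v hv => ?_) (V.2.trans V'.2.symm))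
  by_contra hv'
  obtain ⟨f, hf1, hf0, hfs, hf01⟩ := exists_continuous_one_zero_of_isCompact
    (isCompact_singleton (x := v)) V'.1.closed_of_finiteDimensional
    (Set.disjoint_singleton_left.2 hv')
  have h0 : ∫ y in (V'.1 : Set E), f y ∂μHE[d] = 0 :=
    setIntegral_eq_zero_of_forall_eq_zero fun y hy => hf0 hy
  obtain ⟨φ, rfl⟩ := Stiefel.range_surjective V
  obtain ⟨z, rfl⟩ := hv
  have hpos : 0 < ∫ z, f (φ.1 z) :=
    (f.continuous.comp φ.1.continuous).integral_pos_of_hasCompactSupport_nonneg_nonzero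
      (φ.hasCompactSupport_comp hfs) (fun y => (hf01 _).1) (x := z) ((hf1 rfl).trans_ne one_ne_zero)
  rw [← h0, ← h f f.continuous hfs, φ.setIntegral_range] at hpos
  exact lt_irrefl _ hpos

end Topology

/-! ### Countable families of test functions and approximation of limits. -/

section CountableFamily

variable {E : Type*} [NormedAddCommGroup E] [ProperSpace E]

/-- A bump function equal to `1` on the ball of radius `R`. -/
theorem exists_bump (R : ℝ) : ∃ χ : C(E, ℝ), HasCompactSupport χ ∧ (∀ x, 0 ≤ χ x) ∧
    ∀ x ∈ Metric.closedBall (0 : E) R, χ x = 1 := by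
  obtain ⟨χ, h1, -, hs, h01⟩ := exists_continuous_one_zero_of_isCompact
    (isCompact_closedBall (0 : E) R) isClosed_empty (Set.disjoint_empty _)
  exact ⟨χ, hs, fun x => (h01 x).1, h1⟩

-- Products of cutoffs with a countable dense subset of `C(E, ℝ)`. Weighting the error by a `χ` that
-- is itself in `D` keeps it under control when integrating against blow-ups of unbounded total
-- mass.
variable (E) in
theorem exists_countable_testFunctions : ∃ D : Set C(E, ℝ), D.Countable ∧
    (∀ g ∈ D, HasCompactSupport g) ∧
    ∀ f : E → ℝ, Continuous f → HasCompactSupport f → ∃ χ ∈ D, ∀ ε > 0, ∃ g ∈ D,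
      ∀ x, |f x - g x| ≤ ε * χ x := by
  choose χ hχs hχ0 hχ1 using fun n : ℕ => exists_bump (E := E) n
  obtain ⟨P, hPc, hPd⟩ := TopologicalSpace.exists_countable_dense C(E, ℝ)
  refine ⟨Set.range χ ∪ Set.image2 (fun n p => χ n * p) Set.univ P,
    (Set.countable_range χ).union (Set.countable_univ.image2 hPc _), ?_, fun f hf hs => ?_⟩
  · rintro _ (⟨n, rfl⟩ | ⟨n, -, p, -, rfl⟩)
    · exact hχs n
    · exact (hχs n).mul_right
  · obtain ⟨R, hR⟩ := hs.isCompact.isBounded.exists_norm_le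
    obtain ⟨n, hn⟩ := exists_nat_ge R
    refine ⟨χ n, .inl ⟨n, rfl⟩, fun ε hε => ?_⟩
    have hev : ∀ᶠ p : C(E, ℝ) in 𝓝 ⟨f, hf⟩, ∀ x ∈ tsupport (χ n), dist (f x) (p x) < ε :=
      Metric.tendstoUniformlyOn_iff.1
        (ContinuousMap.tendsto_iff_forall_isCompact_tendstoUniformlyOn.1
          (tendsto_id (x := 𝓝 (⟨f, hf⟩ : C(E, ℝ)))) _ (hχs n)) ε hε
    obtain ⟨p, hpP, hp⟩ := hPd.exists_mem_open isOpen_interior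
      ⟨_, mem_interior_iff_mem_nhds.2 hev⟩
    refine ⟨χ n * p, .inr ⟨n, trivial, p, hpP, rfl⟩, fun x => ?_⟩
    have hfx : f x = χ n x * f x := by
      by_cases hx : f x = 0
      · simp [hx]
      · rw [hχ1 n x (mem_closedBall_zero_iff.2 ((hR x (subset_tsupport f hx)).trans hn)), one_mul]
    rw [ContinuousMap.mul_apply, hfx, ← mul_sub, abs_mul, abs_of_nonneg (hχ0 n x), mul_comm]
    by_cases hx : χ n x = 0
    · simp [hx]
    · exact mul_le_mul_of_nonneg_right (interior_subset hp x (subset_tsupport _ hx)).le (hχ0 n x)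

end CountableFamily

/-- If continuous functions on `(0, ∞)` converge along the rationals, they converge. -/
theorem tendsto_nhdsGT_zero_of_tendsto_rat {g : ℝ → ℝ} (hg : ContinuousOn g (Set.Ioi 0)) {c : ℝ}
    (h : Tendsto (fun q : ℚ => g q) (comap (fun q : ℚ => (q : ℝ)) (𝓝[>] 0)) (𝓝 c)) :
    Tendsto g (𝓝[>] 0) (𝓝 c) := by
  refine Metric.nhds_basis_closedBall.tendsto_right_iff.2 fun ε hε => ?_
  have h1 := h.eventually_mem (Metric.closedBall_mem_nhds c hε)
  rw [eventually_comap] at h1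
  obtain ⟨δ, hδ, h2⟩ := mem_nhdsGT_iff_exists_Ioo_subset.1 h1
  filter_upwards [Ioo_mem_nhdsGT hδ] with r hr
  have hr' : r ∈ closure (Set.Ioo 0 δ ∩ Set.range ((↑) : ℚ → ℝ)) :=
    Rat.denseRange_cast.open_subset_closure_inter isOpen_Ioo hr
  have hc : ContinuousWithinAt g (Set.Ioo 0 δ ∩ Set.range ((↑) : ℚ → ℝ)) r :=
    ((hg r hr.1).mono fun x hx => hx.1.1)
  have hm : Set.MapsTo g (Set.Ioo 0 δ ∩ Set.range ((↑) : ℚ → ℝ)) (Metric.closedBall c ε) := by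
    rintro _ ⟨hq, q, rfl⟩
    exact h2 hq q rfl
  have := hc.mem_closure hr' hm
  rwa [Metric.isClosed_closedBall.closure_eq] at this

/-- Integration against a measure is Lipschitz with respect to weighted sup norms. -/
theorem abs_integral_sub_integral_le {E : Type*} [MeasurableSpace E] {ν : Measure E} {f g χ : E → ℝ} (hf : Integrable f ν)
    (hg : Integrable g ν) (hχ : Integrable χ ν) {ε : ℝ} (h : ∀ x, |f x - g x| ≤ ε * χ x) :
    |∫ x, f x ∂ν - ∫ x, g x ∂ν| ≤ ε * ∫ x, χ x ∂ν := by
  rw [← integral_sub hf hg, ← integral_const_mul]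
  exact (abs_integral_le_integral_abs).trans (integral_mono (hf.sub hg).abs (hχ.const_mul ε) h)

/-- A convergence criterion by approximation with a controlled error. -/
theorem tendsto_of_forall_approx {ι : Type*} {l : Filter ι} {a : ι → ℝ} {b : ℝ} {m : ι → ℝ} {M : ℝ}
    (hm : Tendsto m l (𝓝 M))
    (h : ∀ ε > 0, ∃ (a' : ι → ℝ) (b' : ℝ), Tendsto a' l (𝓝 b') ∧
      (∀ᶠ i in l, |a i - a' i| ≤ ε * m i) ∧ |b - b'| ≤ ε * M) :
    Tendsto a l (𝓝 b) := by
  rw [Metric.tendsto_nhds]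
  intro η hη
  have hM : 0 < 2 * |M| + 2 := by positivity
  -- The two approximation errors add up to at most `ε * (2 * |M| + 1) < η / 2`.
  obtain ⟨a', b', ha', haa', hbb'⟩ := h (η / (2 * |M| + 2) / 2) (by positivity)
  have hε : 0 < η / (2 * |M| + 2) / 2 := by positivity
  set ε := η / (2 * |M| + 2) / 2 with hεd
  have hεη : ε * (2 * |M| + 2) = η / 2 := by rw [hεd]; field_simp
  filter_upwards [haa', hm.eventually (gt_mem_nhds (lt_add_one M)),
    Metric.tendsto_nhds.1 ha' (η / 2) (by positivity)] with i h1 h2 h3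
  rw [Real.dist_eq] at h3 ⊢
  have h4 : ε * m i ≤ ε * (|M| + 1) := by
    gcongr
    exact h2.le.trans (by gcongr; exact le_abs_self M)
  have h5 : ε * M ≤ ε * |M| := by gcongr; exact le_abs_self M
  have h6 : a i - b = (a i - a' i) + (a' i - b') - (b - b') := by ring
  rw [h6]
  have h7 := abs_sub ((a i - a' i) + (a' i - b')) (b - b')
  have h8 := abs_add_le (a i - a' i) (a' i - b')
  linarith

/-! ### Measurability of the tangent space. -/

section Tangent

variable {E : Type*} [NormedAddCommGroup E] [InnerProductSpace ℝ E]
  [MeasurableSpace E] [BorelSpace E] {d : ℕ} {X : Set E}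

variable (d X) in
/-- The integral of a test function over the blow-up of `X` at `x` with scale `r`. -/
noncomputable def blowup (f : E → ℝ) (r : ℝ) (x : E) : ℝ :=
  (r ^ d)⁻¹ * ∫ y in X, f (r⁻¹ • (y - x)) ∂μHE[d]

theorem continuousOn_blowup (hX : μHE[d] X < ⊤) {f : E → ℝ} (hf : Continuous f)
    (hs : HasCompactSupport f) :
    ContinuousOn (fun p : ℝ × E => blowup d X f p.1 p.2) (Set.Ioi 0 ×ˢ Set.univ) := by
  have : IsFiniteMeasure ((μHE[d] : Measure E).restrict X) := ⟨by simpa using hX⟩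
  obtain ⟨M, hM⟩ := hs.exists_bound_of_continuous hf
  refine ContinuousOn.mul (ContinuousOn.inv₀ (by fun_prop) fun p hp => (pow_pos hp.1 d).ne') ?_
  refine continuousOn_of_dominated (bound := fun _ => M) (fun p _ => ?_)
    (fun p _ => ae_of_all _ fun y => hM _) (integrable_const _) (ae_of_all _ fun y => ?_)
  · exact (hf.comp (by fun_prop)).aestronglyMeasurable
  · exact hf.comp_continuousOn (((continuousOn_fst.inv₀ fun p hp => (ne_of_gt hp.1))).smul
      (by fun_prop))

theorem measurable_blowup (hX : μHE[d] X < ⊤) {f : E → ℝ} (hf : Continuous f)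
    (hs : HasCompactSupport f) {r : ℝ} (hr : 0 < r) : Measurable (blowup d X f r) :=
  ((continuousOn_blowup hX hf hs).comp_continuous (Continuous.prodMk_right r)
    fun _ => ⟨hr, trivial⟩).measurable

theorem integrable_blowup (hX : μHE[d] X < ⊤) {f : E → ℝ} (hf : Continuous f)
    (hs : HasCompactSupport f) (r : ℝ) (x : E) :
    IntegrableOn (fun y => f (r⁻¹ • (y - x))) X μHE[d] := by
  have : IsFiniteMeasure ((μHE[d] : Measure E).restrict X) := ⟨by simpa using hX⟩
  obtain ⟨M, hM⟩ := hs.exists_bound_of_continuous hf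
  exact Integrable.of_bound (hf.comp (by fun_prop)).aestronglyMeasurable M (ae_of_all _ fun y => hM _)

variable [FiniteDimensional ℝ E]

/-- Tangency may be tested on a sufficiently rich family of test functions and rational scales. -/
theorem isTangentSpace_of_forall_rat (hX : μHE[d] X < ⊤) {D : Set C(E, ℝ)}
    (hDs : ∀ g ∈ D, HasCompactSupport g)
    (hD : ∀ f : E → ℝ, Continuous f → HasCompactSupport f → ∃ χ ∈ D, ∀ ε > 0, ∃ g ∈ D,
      ∀ x, |f x - g x| ≤ ε * χ x) {x : E} {V : Grassmannian d E}
    (h : ∀ g ∈ D, Tendsto (fun q : ℚ => blowup d X g q x) (comap (fun q : ℚ => (q : ℝ)) (𝓝[>] 0))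
      (𝓝 (∫ y in (V.1 : Set E), g y ∂μHE[d]))) : IsTangentSpace X x V := by
  have h' : ∀ g ∈ D, Tendsto (fun r => blowup d X g r x) (𝓝[>] 0)
      (𝓝 (∫ y in (V.1 : Set E), g y ∂μHE[d])) := fun g hg =>
    tendsto_nhdsGT_zero_of_tendsto_rat ((continuousOn_blowup hX g.continuous (hDs g hg)).comp
      (f := fun r => (r, x)) (by fun_prop) fun r hr => ⟨hr, trivial⟩) (h g hg)
  intro f hf hs
  obtain ⟨χ, hχ, hfχ⟩ := hD f hf hs
  refine tendsto_of_forall_approx (h' χ hχ) fun ε hε => ?_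
  obtain ⟨g, hg, hfg⟩ := hfχ ε hε
  refine ⟨_, _, h' g hg, ?_, ?_⟩
  · filter_upwards [self_mem_nhdsWithin] with r hr
    have hr0 : 0 ≤ (r ^ d)⁻¹ := inv_nonneg.2 (pow_nonneg (le_of_lt hr) d)
    rw [blowup, blowup, ← mul_sub, abs_mul, abs_of_nonneg hr0, mul_left_comm]
    exact mul_le_mul_of_nonneg_left (abs_integral_sub_integral_le
      (integrable_blowup hX hf hs r x) (integrable_blowup hX g.continuous (hDs g hg) r x)
      (integrable_blowup hX χ.continuous (hDs χ hχ) r x) fun y => hfg _) hr0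
  · exact abs_integral_sub_integral_le (V.integrableOn hf hs)
      (V.integrableOn g.continuous (hDs g hg)) (V.integrableOn χ.continuous (hDs χ hχ)) hfg

/-- The tangent space of a set of finite measure is a Borel function of the point. -/
theorem measurable_tangentSpace (hd : d ≤ Module.finrank ℝ E) (hX : μHE[d] X < ⊤) :
    Measurable (tangentSpace hd X) := by
  obtain ⟨D, hDc, hDs, hD⟩ := exists_countable_testFunctions E
  have := hDc.to_subtype
  -- Tangency of `V` at `x` becomes convergence of `F · x` to `Φ V` in a countable product, along
  -- positive rational scales.
  let Φ : Grassmannian d E → D → ℝ := fun V g => ∫ y in (V.1 : Set E), g.1 y ∂μHE[d]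
  let l : Filter {q : ℚ // 0 < q} := comap (fun q => ((q : ℚ) : ℝ)) (𝓝[>] 0)
  let F : {q : ℚ // 0 < q} → E → D → ℝ := fun q x g => blowup d X g.1 q x
  have hl : comap (fun q : ℚ => (q : ℝ)) (𝓝[>] 0) = map Subtype.val l := by
    have : l = comap Subtype.val (comap (fun q : ℚ => (q : ℝ)) (𝓝[>] 0)) := comap_comap.symm
    rw [this, map_comap_of_mem]
    exact ⟨Set.Ioi 0, self_mem_nhdsWithin, fun q hq => ⟨⟨q, (Rat.cast_pos (K := ℝ)).1 hq⟩, rfl⟩⟩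
  have hF : ∀ q, Measurable (F q) := fun q => measurable_pi_iff.2 fun g =>
    measurable_blowup hX g.1.continuous (hDs _ g.2) (Rat.cast_pos.2 q.2)
  have hiff : ∀ x V, IsTangentSpace X x V ↔ Tendsto (F · x) l (𝓝 (Φ V)) := by
    intro x V
    rw [tendsto_pi_nhds]
    constructor
    · intro h g
      exact (h g.1 g.1.continuous (hDs _ g.2)).comp tendsto_comap
    · intro h
      refine isTangentSpace_of_forall_rat hX hDs hD fun g hg => ?_
      rw [hl, tendsto_map'_iff]
      exact h ⟨g, hg⟩
  have : l.NeBot := by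
    refine comap_neBot_iff.2 fun t ht => ?_
    obtain ⟨δ, hδ, ht⟩ := mem_nhdsGT_iff_exists_Ioo_subset.1 ht
    obtain ⟨q, hq0, hqδ⟩ := exists_rat_btwn (Set.mem_Ioi.1 hδ)
    exact ⟨⟨q, Rat.cast_pos.1 hq0⟩, ht ⟨hq0, hqδ⟩⟩
  -- A continuous injection of a compact space into a Hausdorff one; measurability may then be
  -- checked after composing with `Φ`.
  have hΦ : IsClosedEmbedding Φ := by
    refine Continuous.isClosedEmbedding (continuous_pi fun g =>
      Grassmannian.continuous_setIntegral g.1.continuous (hDs _ g.2)) fun V V' hVV' => ?_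
    refine Grassmannian.ext_of_setIntegral_eq fun f hf hs => ?_
    obtain ⟨χ, hχ, hfχ⟩ := hD f hf hs
    have hχV : ∫ y in (V.1 : Set E), χ y ∂μHE[d] = ∫ y in (V'.1 : Set E), χ y ∂μHE[d] :=
      congrFun hVV' ⟨χ, hχ⟩
    -- The two numbers are compared as limits of one constant family.
    refine tendsto_nhds_unique (f := fun _ : Unit => ∫ y in (V.1 : Set E), f y ∂μHE[d])
      (l := ⊤) tendsto_const_nhds
      (tendsto_of_forall_approx (m := fun _ => ∫ y in (V'.1 : Set E), χ y ∂μHE[d])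
        tendsto_const_nhds fun ε hε => ?_)
    obtain ⟨g, hg, hfg⟩ := hfχ ε hε
    have hgV : ∫ y in (V.1 : Set E), g y ∂μHE[d] = ∫ y in (V'.1 : Set E), g y ∂μHE[d] :=
      congrFun hVV' ⟨g, hg⟩
    have hle : ∀ V : Grassmannian d E, _ := fun V => abs_integral_sub_integral_le
      (V.integrableOn hf hs) (V.integrableOn g.continuous (hDs g hg))
      (V.integrableOn χ.continuous (hDs χ hχ)) hfg
    refine ⟨fun _ => ∫ y in (V'.1 : Set E), g y ∂μHE[d], _, tendsto_const_nhds,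
      .of_forall fun _ => ?_, hle V'⟩
    rw [← hgV, ← hχV]
    exact hle V
  rw [← hΦ.measurableEmbedding.measurable_comp_iff]
  -- By `hiff`, these are exactly the points that have a tangent space.
  let A : Set E := {x | ∃ c, Tendsto (F · x) l (𝓝 c)} ∩
    (fun x => limUnder l (F · x)) ⁻¹' Set.range Φ
  have hlim : Measurable fun x => limUnder l (F · x) :=
    (StronglyMeasurable.limUnder fun q => (hF q).stronglyMeasurable).measurable
  have hA : MeasurableSet A := (measurableSet_exists_tendsto hF).inter
    (hlim hΦ.isClosed_range.measurableSet)
  classical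
  have : Φ ∘ tangentSpace hd X = A.piecewise (fun x => limUnder l (F · x))
      fun _ => Φ (Grassmannian.nonempty hd).some := by
    funext x
    by_cases hx : ∃ V : Grassmannian d E, IsTangentSpace X x V
    · have hT : tangentSpace hd X x = hx.choose := dif_pos hx
      have h1 := ((hiff x _).1 hx.choose_spec)
      have hxA : x ∈ A := ⟨⟨_, h1⟩, ⟨_, h1.limUnder_eq.symm⟩⟩
      rw [Set.piecewise_eq_of_mem _ _ _ hxA, Function.comp_apply, hT, h1.limUnder_eq]
    · have hxA : x ∉ A := by
        rintro ⟨h1, V, hV⟩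
        refine hx ⟨V, (hiff x V).2 ?_⟩
        rw [hV]
        exact tendsto_nhds_limUnder h1
      rw [Set.piecewise_eq_of_notMem _ _ _ hxA, Function.comp_apply, tangentSpace, dif_neg hx]
  rw [this]
  exact hlim.piecewise hA measurable_const

end Tangent

/-! ### Reproducing kernel Hilbert spaces with continuous kernel. -/

section Kernel

variable {Z : Type*} {W : Type*} [NormedAddCommGroup W] [InnerProductSpace ℝ W] [CompleteSpace W]
  [RKHS ℝ W Z ℝ]

theorem inner_kerFun_one (p : Z) (ω : W) : inner ℝ (RKHS.kerFun W p (1 : ℝ)) ω = ω p := by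
  simp

/-- If the kernel is continuous, the feature map of the reproducing kernel Hilbert space is. -/
theorem continuous_kerFun [TopologicalSpace Z] {k : Z → Z → ℝ}
    (hk : ∀ p q, RKHS.kernel W p q (1 : ℝ) = k p q) (hc : Continuous (Function.uncurry k)) :
    Continuous fun p => RKHS.kerFun W p (1 : ℝ) := by
  have hinner : ∀ p q, inner ℝ (RKHS.kerFun W p (1 : ℝ)) (RKHS.kerFun W q (1 : ℝ)) = k p q := by
    intro p q
    rw [inner_kerFun_one, RKHS.kerFun_apply, hk]
  refine continuous_iff_continuousAt.2 fun p => ?_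
  rw [ContinuousAt, tendsto_iff_norm_sub_tendsto_zero]
  have hsq : ∀ q, ‖RKHS.kerFun W q (1 : ℝ) - RKHS.kerFun W p (1 : ℝ)‖ =
      √(k q q - 2 * k q p + k p p) := by
    intro q
    rw [← hinner, ← hinner, ← hinner, real_inner_self_eq_norm_sq, real_inner_self_eq_norm_sq,
      ← norm_sub_sq_real, Real.sqrt_sq (norm_nonneg _)]
  simp_rw [hsq]
  have hc' : ∀ f g : Z → Z, Continuous f → Continuous g → Continuous fun q => k (f q) (g q) :=
    fun f g hf hg => hc.comp (hf.prodMk hg)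
  have : Continuous fun q => √(k q q - 2 * k q p + k p p) :=
    (((hc' _ _ continuous_id continuous_id).sub
      (continuous_const.mul (hc' _ _ continuous_id continuous_const))).add continuous_const).sqrt
  have h := this.tendsto p
  rwa [show k p p - 2 * k p p + k p p = 0 by ring, Real.sqrt_zero] at h

/-- On a compact set, some element of a reproducing kernel Hilbert space with nonnegative
continuous kernel, positive on the diagonal, is bounded below by a positive constant. -/
theorem exists_forall_le_apply [TopologicalSpace Z] {k : Z → Z → ℝ}
    (hk : ∀ p q, RKHS.kernel W p q (1 : ℝ) = k p q) (hc : Continuous (Function.uncurry k))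
    (h0 : ∀ p q, 0 ≤ k p q) (hpos : ∀ p, 0 < k p p) {K : Set Z} (hK : IsCompact K) :
    ∃ ω : W, ∃ c > 0, ∀ z ∈ K, c ≤ ω z := by
  -- Positivity on the diagonal makes each `{z | 0 < k z p}` an open neighbourhood of `p`.
  obtain ⟨t, -, ht⟩ := hK.elim_nhds_subcover (fun p => {z | 0 < k z p}) fun p _ =>
    (isOpen_lt continuous_const (hc.comp (.prodMk_left p))).mem_nhds (hpos p)
  let ω : W := ∑ p ∈ t, RKHS.kerFun W p (1 : ℝ)
  have hω : ∀ z, ω z = ∑ p ∈ t, k z p := by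
    intro z
    rw [← inner_kerFun_one, inner_sum]
    exact Finset.sum_congr rfl fun p _ => by rw [inner_kerFun_one, RKHS.kerFun_apply, hk]
  refine ⟨ω, ?_⟩
  have hpos' : ∀ z ∈ K, 0 < ω z := by
    intro z hz
    obtain ⟨p, hp, hzp⟩ := Set.mem_iUnion₂.1 (ht hz)
    rw [hω]
    exact Finset.sum_pos' (fun q _ => h0 z q) ⟨p, hp, hzp⟩
  have hcont : Continuous fun z => ω z := by
    simp_rw [hω]
    exact continuous_finsetSum _ fun p _ => hc.comp (.prodMk_left p)
  obtain rfl | hne := K.eq_empty_or_nonempty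
  · exact ⟨1, one_pos, fun z hz => hz.elim⟩
  · obtain ⟨z, hz, hmin⟩ := hK.exists_isMinOn hne hcont.continuousOn
    exact ⟨ω z, hpos' z hz, fun y hy => hmin hy⟩

/-- A finite measure carried by a compact set acts on a reproducing kernel Hilbert space with
continuous kernel as a continuous linear form. -/
theorem exists_dual_eq_integral [TopologicalSpace Z] [SecondCountableTopology Z] [MeasurableSpace Z]
    [OpensMeasurableSpace Z] {k : Z → Z → ℝ}
    (hk : ∀ p q, RKHS.kernel W p q (1 : ℝ) = k p q) (hc : Continuous (Function.uncurry k))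
    {K : Set Z} (hK : IsCompact K) {ν : Measure Z} [IsFiniteMeasure ν] (hν : ∀ᵐ z ∂ν, z ∈ K) :
    ∃ L : StrongDual ℝ W, ∀ ω : W, Integrable (fun z => ω z) ν ∧ L ω = ∫ z, ω z ∂ν := by
  have hcont := continuous_kerFun (W := W) hk hc
  obtain ⟨M, hM⟩ := hK.exists_bound_of_continuousOn hcont.continuousOn
  have hint : Integrable (fun z => RKHS.kerFun W z (1 : ℝ)) ν :=
    .of_bound hcont.aestronglyMeasurable M (hν.mono hM)
  refine ⟨innerSL ℝ (∫ z, RKHS.kerFun W z (1 : ℝ) ∂ν), fun ω => ?_⟩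
  have h : ∀ z, ω z = inner ℝ ω (RKHS.kerFun W z (1 : ℝ)) := fun z => by
    rw [real_inner_comm, inner_kerFun_one]
  simp_rw [h]
  exact ⟨hint.const_inner ω, by rw [integral_inner hint, innerSL_apply_apply, real_inner_comm]⟩

end Kernel

/-! ### Total mass and support of the varifold. -/

section Measure

variable {E : Type*} [NormedAddCommGroup E] [InnerProductSpace ℝ E] [FiniteDimensional ℝ E]
  [MeasurableSpace E] [BorelSpace E] {d : ℕ} {X : Set E}

theorem measurable_graph_tangentSpace (hd : d ≤ Module.finrank ℝ E) (hX : μHE[d] X < ⊤) :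
    Measurable fun x => (x, tangentSpace hd X x) :=
  measurable_id.prodMk (measurable_tangentSpace hd hX)

theorem rectifiableVarifold_univ (hd : d ≤ Module.finrank ℝ E) (hX : μHE[d] X < ⊤) :
    rectifiableVarifold hd X Set.univ = μHE[d] X := by
  rw [rectifiableVarifold, Measure.map_apply (measurable_graph_tangentSpace hd hX) .univ]
  simp

theorem ae_rectifiableVarifold_mem (hd : d ≤ Module.finrank ℝ E) (hX : μHE[d] X < ⊤) {B : Set E}
    (hB : MeasurableSet B) (hXB : X ⊆ B) :
    ∀ᵐ z ∂(rectifiableVarifold hd X), z ∈ B ×ˢ Set.univ := by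
  refine (ae_map_iff (p := fun z => z ∈ B ×ˢ Set.univ)
    (measurable_graph_tangentSpace hd hX).aemeasurable (hB.prod .univ)).2 ?_
  have : ∀ᵐ x ∂((μHE[d] : Measure E).restrict X), x ∈ B :=
    (ae_restrict_iff hB).2 (ae_of_all _ fun x hx => hXB hx)
  filter_upwards [this] with x hx
  exact ⟨hx, trivial⟩

end Measure

end Varifold

theorem mainTheorem3
    {E : Type*} [NormedAddCommGroup E] [InnerProductSpace ℝ E] [FiniteDimensional ℝ E]
    [MeasurableSpace E] [BorelSpace E]
    {d : ℕ} (hd : d ≤ Module.finrank ℝ E)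
    -- the radial kernel on `E`
    (ke : E → E → ℝ) (hke : (Matrix.of ke).PosSemidef)
    (he : ℝ → ℝ) (hke_radial : ∀ x y, ke x y = he ‖x - y‖)
    (he_cont : ContinuousOn he (Set.Ici 0)) (he_nonneg : ∀ r, 0 ≤ r → 0 ≤ he r)
    (he_zero : 0 < he 0)
    -- the kernel on the Grassmannian
    (kt : Varifold.Grassmannian d E → Varifold.Grassmannian d E → ℝ)
    (hkt : (Matrix.of kt).PosSemidef)
    (kt_cont : Continuous (Function.uncurry kt)) (kt_nonneg : ∀ u v, 0 ≤ kt u v)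
    (kt_diag : ∀ u, 0 < kt u u)
    -- the reproducing kernel Hilbert space of the tensor product kernel
    {W : Type*} [NormedAddCommGroup W] [InnerProductSpace ℝ W] [CompleteSpace W]
    [RKHS ℝ W (E × Varifold.Grassmannian d E) ℝ]
    (hW : ∀ p q : E × Varifold.Grassmannian d E,
      RKHS.kernel W p q (1 : ℝ) = ke p.1 q.1 * kt p.2 q.2) :
    ∃ C : ℝ, 0 < C ∧ ∀ X : Set E, Varifold.IsRectifiable d X → X ⊆ Metric.closedBall 0 1 →
      -- the varifold of `X` acts on `W` as a continuous linear form `L`, and `‖L‖ ≥ C ℋ^d(X)`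
      ∃ L : StrongDual ℝ W,
        (∀ ω : W,
          Integrable (fun z => ω z) (Varifold.rectifiableVarifold hd X) ∧
          L ω = ∫ z, ω z ∂(Varifold.rectifiableVarifold hd X)) ∧
        C * (μHE[d] X).toReal ≤ ‖L‖ := by
  let k : E × Varifold.Grassmannian d E → E × Varifold.Grassmannian d E → ℝ :=
    fun p q => he ‖p.1 - q.1‖ * kt p.2 q.2
  have hk : ∀ p q, RKHS.kernel W p q (1 : ℝ) = k p q := fun p q => by rw [hW, hke_radial]
  have hc : Continuous (Function.uncurry k) :=
    (he_cont.comp_continuous (by fun_prop) fun _ => norm_nonneg _).mul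
      (kt_cont.comp ((continuous_snd.comp continuous_fst).prodMk
        (continuous_snd.comp continuous_snd)))
  have h0 : ∀ p q, 0 ≤ k p q := fun p q =>
    mul_nonneg (he_nonneg _ (norm_nonneg _)) (kt_nonneg _ _)
  have hpos : ∀ p, 0 < k p p := fun p =>
    mul_pos (by rwa [sub_self, norm_zero]) (kt_diag _)
  have hK : IsCompact (Metric.closedBall (0 : E) 1 ×ˢ
      (Set.univ : Set (Varifold.Grassmannian d E))) :=
    (isCompact_closedBall _ _).prod isCompact_univ
  obtain ⟨ω, c, hc0, hω⟩ := Varifold.exists_forall_le_apply (W := W) hk hc h0 hpos hK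
  -- The `+ 1` avoids having to check `ω ≠ 0`.
  refine ⟨c / (‖ω‖ + 1), by positivity, fun X hX hXB => ?_⟩
  have hXfin := hX.2.1
  have hae := Varifold.ae_rectifiableVarifold_mem hd hXfin
    Metric.isClosed_closedBall.measurableSet hXB
  have huniv := Varifold.rectifiableVarifold_univ hd hXfin
  have : IsFiniteMeasure (Varifold.rectifiableVarifold hd X) := ⟨huniv.trans_lt hXfin⟩
  obtain ⟨L, hL⟩ := Varifold.exists_dual_eq_integral (W := W) hk hc hK hae
  refine ⟨L, hL, ?_⟩
  have h1 : c * (μHE[d] X).toReal ≤ L ω := by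
    have := integral_mono_ae (integrable_const c) (hL ω).1 (hae.mono hω)
    rwa [← (hL ω).2, integral_const, smul_eq_mul, mul_comm, Measure.real, huniv] at this
  have h2 : L ω ≤ ‖L‖ * (‖ω‖ + 1) := by
    refine (le_abs_self _).trans ((L.le_opNorm ω).trans ?_)
    gcongr
    exact le_add_of_nonneg_right zero_le_one
  rw [div_mul_eq_mul_div, div_le_iff₀ (by positivity)]
  exact h1.trans h2
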